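/- Let $k\ge 2$ be an integer and let $G$ be a finite simple graph that is $1$-tough, $k$-connected and $(P_2\cup kP_1)$-free. If the essential independence number satisfies $\alpha_e(G)\le k$, then $G$ is hamiltonian, i.e. $G$ has a cycle containing every vertex of $G$. Here: - $G$ is $1$-tough if $|S|\ge \omega(G-S)$ for every vertex cut $S$ of $G$ (a set $S\subseteq V(G)$ such that $G-S$ is disconnected), where $\omega$ denotes the number of connected components. - $G$ is $k$-connected if $|V(G)|>k$ and $G-S$ is connected for every $S\subseteq V(G)$ with $|S|<k$. - $P_2\cup kP_1$ is the graph consisting of one edge and $k$ isolated vertices, and $G$ is $(P_2\cup kP_1)$-free if no induced subgraph of $G$ is isomorphic to it. - An $n$-essential independent set of $G$ is an independent set $S$ of $G$ with $|S|=n$ that contains a vertex $x$ (its center) such that $\mathrm{dist}_G(x,v)=2$ for all $v\in S\setminus\{x\}$; $\alpha_e(G)$ is the maximum integer $n$ such that $G$ contains an $n$-essential independent set. -/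

import Mathlib

namespace SimpleGraph

variable {V : Type*}

/-- The graph `G - S` obtained by deleting the vertices in `S`. -/
abbrev deleteVertexSet (G : SimpleGraph V) (S : Finset V) : SimpleGraph ((S : Set V)ᶜ : Set V) :=
  G.induce (S : Set V)ᶜ

/-- `S` is a vertex cut of `G`: some two vertices outside `S` lie in different components
of `G - S`. -/
def IsVertexCut (G : SimpleGraph V) (S : Finset V) : Prop :=
  ¬ (G.deleteVertexSet S).Preconnected

/-- A finite graph `G` is `t`-tough if `t * ω(G - S) ≤ |S|` for each vertex cut `S` of `G`, where
`ω` denotes the number of connected components. -/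
def IsTough (G : SimpleGraph V) (t : ℝ) : Prop :=
  ∀ S : Finset V, G.IsVertexCut S →
    t * (Nat.card (G.deleteVertexSet S).ConnectedComponent : ℝ) ≤ (S.card : ℝ)

/-- A finite graph `G` is `k`-connected if it has more than `k` vertices and `G - S` is connected
for every set `S` of fewer than `k` vertices. -/
def IsKConnected (G : SimpleGraph V) (k : ℕ) : Prop :=
  k < Nat.card V ∧ ∀ S : Finset V, S.card < k → (G.deleteVertexSet S).Connected

/-- The graph `P₂ ∪ kP₁`: the disjoint union of an edge and `k` isolated vertices. -/
def P2UnionKP1 (k : ℕ) : SimpleGraph (Fin 2 ⊕ Fin k) :=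
  (pathGraph 2).sum (⊥ : SimpleGraph (Fin k))

/-- `G` is `H`-free: no induced subgraph of `G` is isomorphic to `H`. -/
def IsInducedFree {W : Type*} (G : SimpleGraph V) (H : SimpleGraph W) : Prop :=
  ¬ H.IsIndContained G

/-- `S` is an `n`-essential independent set of `G` with center `x`: an independent set of order `n`
that contains `x` and all of whose other vertices are at distance two from `x`. -/
def IsEssentialIndepSet (G : SimpleGraph V) (n : ℕ) (S : Finset V) (x : V) : Prop :=
  G.IsNIndepSet n S ∧ x ∈ S ∧ ∀ v ∈ S, v ≠ x → G.dist x v = 2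

/-- The essential independence number `α_e(G)` of a finite graph `G`: the maximum `n` such that `G`
contains an `n`-essential independent set. -/
noncomputable def essentialIndepNum (G : SimpleGraph V) : ℕ :=
  sSup {n | ∃ (S : Finset V) (x : V), G.IsEssentialIndepSet n S x}

end SimpleGraph

/-! Take a longest cycle `c`, suppose a vertex `x` lies off it, and let `D` be the component of `x`
in `G - c` and `N` the set of neighbours of `D` on `c`. The set `N` separates `D` from the rest of
`c`, so `k ≤ |N|` (`IsKConnected.le_card_of_separates`). Since `c` cannot be lengthened through `D`,
the successors of `N` have no neighbour in `D` (`exists_longer_of_consecutive`) and are pairwise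
nonadjacent (`exists_longer_of_crossing`). If `x` has a neighbour off `c`, that edge and `k` of the
successors induce `P₂ ∪ kP₁`. Otherwise `D = {x}`, each successor is at distance two from `x`, and
together with `x` they form an essential independent set of order above `k`. -/

namespace SimpleGraph

variable {V : Type*} {G : SimpleGraph V}

/-! ### Cycles as cyclic lists -/

/-- A cyclic sequence of at least three distinct vertices, consecutive ones being adjacent. -/
structure IsCyclicPath (G : SimpleGraph V) (c : Cycle V) : Prop where
  nodup : c.Nodup
  chain : c.Chain G.Adj
  three_le : 3 ≤ c.length

lemma chain_coe_iff {l : List V} (hl : l ≠ []) :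
    (l : Cycle V).Chain G.Adj ↔
      l.IsChain G.Adj ∧ ∀ a ∈ l.getLast?, ∀ b ∈ l.head?, G.Adj a b := by
  obtain ⟨a, l, rfl⟩ := List.exists_cons_of_ne_nil hl
  rw [Cycle.chain_coe_cons, ← List.cons_append, List.isChain_append]
  simp

lemma exists_list_of_reachable_induce {T : Set V} {a b : T} (h : (G.induce T).Reachable a b) :
    ∃ l : List V, l.Nodup ∧ l.IsChain G.Adj ∧ (∀ v ∈ l, v ∈ T) ∧
      l.head? = some a.1 ∧ l.getLast? = some b.1 := by
  classical
  obtain ⟨p⟩ := h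
  refine ⟨p.toPath.1.support.map Subtype.val,
    p.toPath.2.support_nodup.map Subtype.val_injective, ?_, ?_, ?_, ?_⟩
  · rw [List.isChain_map]
    exact p.toPath.1.isChain_adj_support
  · rintro v hv
    obtain ⟨w, -, rfl⟩ := List.mem_map.1 hv
    exact w.2
  · rw [List.head?_map, List.head?_eq_some_head (Walk.support_ne_nil _), Walk.head_support]
    rfl
  · rw [List.getLast?_map, List.getLast?_eq_some_getLast (Walk.support_ne_nil _),
      Walk.getLast_support]
    rfl

lemma IsCyclicPath.exists_isCycle {c : Cycle V} (hc : G.IsCyclicPath c) :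
    ∃ (a : V) (p : G.Walk a a), p.IsCycle ∧ p.length = c.length := by
  obtain ⟨l, rfl⟩ : ∃ l : List V, ↑l = c := Quot.exists_rep c
  obtain ⟨hn, hch, h3⟩ := hc
  simp only [Cycle.nodup_coe_iff, Cycle.length_coe] at hn hch h3
  have hl : l ≠ [] := by rintro rfl; simp at h3
  rw [chain_coe_iff hl] at hch
  have hadj : G.Adj (l.getLast hl) (l.head hl) :=
    hch.2 _ (by simp [List.getLast?_eq_some_getLast hl]) _ (by simp [List.head?_eq_some_head hl])
  have hp : (Walk.ofSupport l hl hch.1).IsPath := by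
    rw [Walk.isPath_def, Walk.support_ofSupport]; exact hn
  have hlen : (Walk.ofSupport l hl hch.1).length = l.length - 1 := by simp
  refine ⟨_, .cons hadj (.ofSupport l hl hch.1), ?_, ?_⟩
  · rw [Walk.cons_isCycle_iff]
    refine ⟨hp, fun h => ?_⟩
    -- A path containing an edge between its two ends is that edge alone, but this path has at least
    -- two edges.
    have := hp.length_eq_one_of_mem_edges (Sym2.eq_swap ▸ h)
    omega
  · rw [Walk.length_cons, hlen, Cycle.length_coe]
    omega

lemma IsCyclicPath.isHamiltonian [Fintype V] [DecidableEq V] {c : Cycle V}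
    (hc : G.IsCyclicPath c) (h : ∀ v, v ∈ c) : G.IsHamiltonian := by
  obtain ⟨a, p, hp, hlen⟩ := hc.exists_isCycle
  refine fun _ => ⟨a, p, Walk.isHamiltonianCycle_iff_isCycle_and_length_eq.2 ⟨hp, ?_⟩⟩
  rw [hlen]
  have hn := hc.nodup
  obtain ⟨l, rfl⟩ : ∃ l : List V, ↑l = c := Quot.exists_rep c
  simp only [Cycle.nodup_coe_iff, Cycle.length_coe, Cycle.mem_coe_iff] at hn h ⊢
  rw [← List.toFinset_card_of_nodup hn, ← Finset.card_univ]
  congr 1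
  ext v
  simp [h v]

/-! ### Successors on a cycle -/

/-- The vertex following `u` on the cycle `c`. -/
def cycleSucc [DecidableEq V] (c : Cycle V) (hn : c.Nodup) (u : V) : V :=
  -- The value off `c` is a dummy; totality allows images of finsets under the successor map.
  if h : u ∈ c then c.next hn u h else u

section Succ

variable [DecidableEq V] {c : Cycle V}

lemma cycleSucc_mem (hn : c.Nodup) {u : V} (hu : u ∈ c) : cycleSucc c hn u ∈ c := by
  rw [cycleSucc, dif_pos hu]
  exact c.next_mem hn u hu

lemma cycleSucc_injOn (hn : c.Nodup) : Set.InjOn (cycleSucc c hn) {u | u ∈ c} := by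
  intro u hu w hw h
  simp only [Set.mem_ofPred_eq] at hu hw
  rw [cycleSucc, dif_pos hu, cycleSucc, dif_pos hw] at h
  rw [← c.prev_next hn u hu, ← c.prev_next hn w hw]
  congr 1

lemma cycleSucc_eq (hn : c.Nodup) {u v : V} {l : List V} (h : c = ↑(v :: (l ++ [u]))) :
    cycleSucc c hn u = v := by
  subst h
  have hu : u ∈ ((v :: (l ++ [u]) : List V) : Cycle V) := by simp
  rw [cycleSucc, dif_pos hu]
  have h := List.next_getLast_eq_head (v :: (l ++ [u])) (by simp) hn
  simp only [List.head_cons] at h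
  refine Eq.trans ?_ h
  change List.next _ _ (Cycle.mem_coe_iff.1 hu) = _
  congr 1
  simp

/-- A cycle, cut open just after `u`. -/
lemma exists_coe_eq_cycleSucc_cons (hn : c.Nodup) (h2 : 2 ≤ c.length) {u : V} (hu : u ∈ c) :
    ∃ l : List V, c = ↑(cycleSucc c hn u :: (l ++ [u])) := by
  obtain ⟨l, rfl⟩ : ∃ l : List V, ↑l = c := Quot.exists_rep c
  simp only [Cycle.mem_coe_iff, Cycle.length_coe] at hu h2 ⊢
  obtain ⟨s, t, rfl⟩ := List.append_of_mem hu
  have hrot : ((s ++ u :: t : List V) : Cycle V) = ↑(t ++ s ++ [u]) := by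
    rw [Cycle.coe_eq_coe]
    have : s ++ u :: t = (s ++ [u]) ++ t := by simp
    rw [this, List.append_assoc t]
    exact List.isRotated_append
  rcases hts : t ++ s with _ | ⟨v, m⟩
  · simp_all
  · rw [hts] at hrot
    have := cycleSucc_eq hn hrot
    exact ⟨m, by rw [this]; exact hrot⟩

end Succ

/-! ### Lengthening a cycle through a path outside it -/

/-- A path avoiding `c` that joins neighbours of two vertices of `c` extends `c` to a longer
cycle if the two vertices are consecutive. -/
lemma IsCyclicPath.exists_longer_of_consecutive {l R : List V} {u v a b : V}
    (hc : G.IsCyclicPath (v :: (l ++ [u]) : List V)) (hRn : R.Nodup) (hR : R.IsChain G.Adj)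
    (hRc : ∀ x ∈ R, x ∉ v :: (l ++ [u])) (ha : R.head? = some a) (hb : R.getLast? = some b)
    (hua : G.Adj u a) (hvb : G.Adj v b) :
    ∃ c' : Cycle V, G.IsCyclicPath c' ∧ (v :: (l ++ [u])).length < c'.length := by
  obtain ⟨hn, hch, h3⟩ := hc
  rw [Cycle.nodup_coe_iff] at hn
  rw [chain_coe_iff (by simp)] at hch
  have hR0 : R ≠ [] := by rintro rfl; simp at ha
  have hpos := List.length_pos_iff.2 hR0
  -- The edge from `u` to `v` is replaced by the detour `u, a, …, b, v`.
  refine ⟨↑((v :: (l ++ [u])) ++ R), ⟨?_, ?_, ?_⟩, ?_⟩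
  · rw [Cycle.nodup_coe_iff, List.nodup_append]
    exact ⟨hn, hRn, fun x hx y hy hxy => hRc y hy (hxy ▸ hx)⟩
  · rw [chain_coe_iff (by simp), List.isChain_append]
    refine ⟨⟨hch.1, hR, ?_⟩, ?_⟩
    · rw [ha, ← List.cons_append, List.getLast?_concat]
      simpa using hua
    · rw [List.getLast?_append, hb]
      simpa using hvb.symm
  · simp only [Cycle.length_coe, List.length_append] at h3 ⊢; omega
  · simp only [Cycle.length_coe, List.length_append]; omega

/-- Rerouting a cycle along a chord joining two successors and a path outside the cycle. -/
lemma IsCyclicPath.exists_longer_of_crossing {P Q R : List V} {u u' w w' a b : V}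
    (hc : G.IsCyclicPath ((P ++ Q : List V) : Cycle V)) (hRn : R.Nodup) (hR : R.IsChain G.Adj)
    (hRc : ∀ x ∈ R, x ∉ P ++ Q) (ha : R.head? = some a) (hb : R.getLast? = some b)
    (hP : P.head? = some u') (hPl : P.getLast? = some w)
    (hQ : Q.head? = some w') (hQl : Q.getLast? = some u)
    (hwa : G.Adj w a) (hub : G.Adj u b) (hadj : G.Adj u' w') :
    ∃ c' : Cycle V, G.IsCyclicPath c' ∧ (P ++ Q).length < c'.length := by
  obtain ⟨hn, hch, h3⟩ := hc
  have hP0 : P ≠ [] := by rintro rfl; simp at hP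
  rw [Cycle.nodup_coe_iff, List.nodup_append] at hn
  rw [chain_coe_iff (by simp [hP0]), List.isChain_append] at hch
  have hR0 : R ≠ [] := by rintro rfl; simp at ha
  have hpos := List.length_pos_iff.2 hR0
  -- Follow `P` from `u'` to `w`, then `R` from `a` to `b`, then `Q` backwards from `u` to `w'`,
  -- closing with the chord `w'u'`.
  refine ⟨↑(P ++ (R ++ Q.reverse)), ⟨?_, ?_, ?_⟩, ?_⟩
  · simp only [List.mem_append] at hRc
    rw [Cycle.nodup_coe_iff, List.nodup_append, List.nodup_append, List.nodup_reverse]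
    refine ⟨hn.1, ⟨hRn, hn.2.1, fun x hx y hy hxy => ?_⟩, fun x hx y hy hxy => ?_⟩
    · exact hRc x hx (Or.inr (by simpa [hxy] using hy))
    · rcases List.mem_append.1 hy with hy | hy
      · exact hRc y hy (Or.inl (hxy ▸ hx))
      · exact hn.2.2 x hx y (by simpa using hy) hxy
  · rw [chain_coe_iff (by simp [hP0]), List.isChain_append, List.isChain_append,
      List.isChain_reverse]
    refine ⟨⟨hch.1.1, ⟨hR, hch.1.2.1.imp fun _ _ h => h.symm, ?_⟩, ?_⟩, ?_⟩
    · simpa [hb, List.head?_reverse, hQl] using hub.symm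
    · simpa [hPl, List.head?_append, ha] using hwa
    · simpa [List.getLast?_append, hQ, List.head?_append, hP] using hadj.symm
  · simp only [Cycle.length_coe, List.length_append, List.length_reverse] at h3 ⊢; omega
  · simp only [Cycle.length_coe, List.length_append, List.length_reverse]; omega

/-! ### Consequences of connectivity -/

/-- A set that is closed under adjacency outside the small set `N` leaves no vertex over. -/
lemma IsKConnected.le_card_of_separates {k : ℕ} (h : G.IsKConnected k) (N : Finset V) (D : Set V)
    {x y : V} (hx : x ∈ D) (hxN : x ∉ N) (hy : y ∉ D) (hyN : y ∉ N)
    (hD : ∀ v ∈ D, ∀ w, G.Adj v w → w ∉ N → w ∈ D) : k ≤ N.card := by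
  by_contra! hlt
  obtain ⟨p⟩ := (h.2 N hlt).preconnected ⟨x, by simpa using hxN⟩ ⟨y, by simpa using hyN⟩
  have key : ∀ a b : ((N : Set V)ᶜ : Set V), ∀ _ : (G.deleteVertexSet N).Walk a b,
      a.1 ∈ D → b.1 ∈ D := by
    intro a b q
    induction q with
    | nil => exact id
    | @cons _ w _ hadj _ ih => exact fun ha => ih (hD _ ha _ hadj fun h => w.2 (Finset.mem_coe.2 h))
  exact hy (key _ _ p hx)

section Connectivity

variable [Fintype V] [DecidableEq V] {k : ℕ}

lemma IsKConnected.exists_adj_ne (h : G.IsKConnected k) (hk : 2 ≤ k) (x y : V) (hxy : x ≠ y) :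
    ∃ b, b ≠ y ∧ G.Adj x b := by
  have hcon := h.2 {y} (by simp; omega)
  have hcard : 2 < Fintype.card V := by rw [← Nat.card_eq_fintype_card]; exact lt_of_le_of_lt hk h.1
  obtain ⟨z, hzx, hzy⟩ : ∃ z, z ≠ x ∧ z ≠ y := by
    have : ({x, y} : Finset V).card < Fintype.card V := lt_of_le_of_lt Finset.card_le_two hcard
    obtain ⟨z, hz⟩ := Finset.exists_mem_notMem_of_card_lt_card (this.trans_eq Finset.card_univ.symm)
    exact ⟨z, by simpa using hz⟩
  let x' : ((({y} : Finset V) : Set V)ᶜ : Set V) := ⟨x, by simpa using hxy⟩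
  let z' : ((({y} : Finset V) : Set V)ᶜ : Set V) := ⟨z, by simpa using hzy⟩
  have : Nontrivial ((({y} : Finset V) : Set V)ᶜ : Set V) :=
    ⟨z', x', fun h => hzx (congrArg Subtype.val h)⟩
  obtain ⟨b, hb⟩ := hcon.preconnected.exists_adj_of_nontrivial x'
  exact ⟨b.1, by simpa using b.2, hb⟩

/-- Two neighbours of a vertex `x` are joined by a path in `G - x`, which closes up through `x`. -/
lemma IsKConnected.exists_isCyclicPath (h : G.IsKConnected k) (hk : 2 ≤ k) :
    ∃ c, G.IsCyclicPath c := by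
  have hcard : 2 < Fintype.card V := by rw [← Nat.card_eq_fintype_card]; exact lt_of_le_of_lt hk h.1
  obtain ⟨x, y, hxy⟩ := Fintype.exists_pair_of_one_lt_card (α := V) (by omega)
  obtain ⟨a, -, ha⟩ := h.exists_adj_ne hk x y hxy
  obtain ⟨b, hba, hb⟩ := h.exists_adj_ne hk x a ha.ne
  have hcon := h.2 {x} (by simp; omega)
  obtain ⟨l, hn, hch, hl, hla, hlb⟩ := exists_list_of_reachable_induce
    (hcon.preconnected ⟨a, by simpa using ha.ne'⟩ ⟨b, by simpa using hb.ne'⟩)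
  have hl0 : l ≠ [] := by rintro rfl; simp at hla
  refine ⟨↑(x :: l), ?_, ?_, ?_⟩
  · rw [Cycle.nodup_coe_iff, List.nodup_cons]
    exact ⟨fun hx => by simpa using hl x hx, hn⟩
  · rw [Cycle.chain_coe_cons, List.isChain_cons, List.isChain_append]
    refine ⟨?_, hch, by simp, ?_⟩
    · simpa [List.head?_append, hla] using ha
    · simpa [hlb] using hb.symm
  · rcases l with _ | ⟨p, _ | ⟨q, l⟩⟩
    · simp at hla
    · simp at hla hlb
      exact absurd (hlb.symm.trans hla) hba
    · simp

lemma IsKConnected.exists_maximal_isCyclicPath (h : G.IsKConnected k) (hk : 2 ≤ k) :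
    ∃ c, G.IsCyclicPath c ∧ ∀ c', G.IsCyclicPath c' → c'.length ≤ c.length := by
  have hbdd : ∀ c, G.IsCyclicPath c → c.length ≤ Fintype.card V := by
    intro c hc
    have hn := hc.nodup
    obtain ⟨l, rfl⟩ : ∃ l : List V, ↑l = c := Quot.exists_rep c
    exact List.Nodup.length_le_card hn
  let S : Set ℕ := {n | ∃ c, G.IsCyclicPath c ∧ c.length = n}
  have hne : S.Nonempty := let ⟨c, hc⟩ := h.exists_isCyclicPath hk; ⟨_, c, hc, rfl⟩
  have hS : BddAbove S := ⟨Fintype.card V, by rintro _ ⟨c, hc, rfl⟩; exact hbdd c hc⟩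
  obtain ⟨c, hc, hlen⟩ := Nat.sSup_mem hne hS
  exact ⟨c, hc, fun c' hc' => hlen ▸ le_csSup hS ⟨c', hc', rfl⟩⟩

end Connectivity

/-! ### The two excluded configurations -/

lemma isIndContained_P2UnionKP1 {k : ℕ} {S : Finset V} (hS : k ≤ S.card) {x y : V}
    (hxy : G.Adj x y) (hind : ∀ u ∈ S, ∀ v ∈ S, ¬ G.Adj u v)
    (hx : ∀ v ∈ S, ¬ G.Adj x v) (hy : ∀ v ∈ S, ¬ G.Adj y v) : (P2UnionKP1 k).IsIndContained G := by
  let e : Fin k → V := fun i => (S.equivFin.symm (Fin.castLE hS i)).1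
  have heS : ∀ i, e i ∈ S := fun i => (S.equivFin.symm (Fin.castLE hS i)).2
  have heinj : Function.Injective e := fun i j hij => by
    have := S.equivFin.symm.injective (Subtype.ext hij)
    simpa using this
  have hxS : x ∉ S := fun h => hy x h hxy.symm
  have hyS : y ∉ S := fun h => hx y h hxy
  let f : Fin 2 ⊕ Fin k → V := Sum.elim ![x, y] e
  have hf : Function.Injective f := by
    refine Function.Injective.sumElim ?_ heinj ?_
    · intro i j
      fin_cases i <;> fin_cases j <;> simp [hxy.ne, hxy.ne']
    · intro i j h
      fin_cases i
      · exact hxS (by simpa [← h] using heS j)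
      · exact hyS (by simpa [← h] using heS j)
  refine ⟨⟨⟨f, hf⟩, ?_⟩⟩
  have h0 : ∀ (i : Fin 2) (j : Fin k), ¬ G.Adj (![x, y] i) (e j) := by
    intro i j
    fin_cases i
    · exact hx _ (heS j)
    · exact hy _ (heS j)
  rintro (i | i) (j | j)
  · fin_cases i <;> fin_cases j <;>
      simp [f, P2UnionKP1, pathGraph_adj, hxy, hxy.symm]
  · simpa [f, P2UnionKP1, SimpleGraph.sum] using h0 i j
  · simpa [f, P2UnionKP1, SimpleGraph.sum] using fun h => h0 j i h.symm
  · simpa [f, P2UnionKP1] using hind _ (heS i) _ (heS j)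

lemma dist_eq_two_of_adj_adj {u v w : V} (huv : G.Adj u v) (hvw : G.Adj v w) (hne : u ≠ w)
    (hnadj : ¬ G.Adj u w) : G.dist u w = 2 :=
  le_antisymm (dist_le (.cons huv (.cons hvw .nil)))
    ((huv.reachable.trans hvw.reachable).one_lt_dist_of_ne_of_not_adj hne hnadj)

lemma card_lt_essentialIndepNum [Fintype V] [DecidableEq V] {S : Finset V} {x : V} (hxS : x ∉ S)
    (hind : ∀ u ∈ S, ∀ v ∈ S, ¬ G.Adj u v) (hx : ∀ v ∈ S, ¬ G.Adj x v)
    (hdist : ∀ v ∈ S, G.dist x v = 2) : S.card < G.essentialIndepNum := by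
  -- The centre `x` supplies the extra element. The bound `|V|` is needed because `sSup` of an
  -- unbounded set of naturals is `0`.
  refine Nat.lt_of_succ_le (le_csSup ⟨Fintype.card V, ?_⟩ ⟨insert x S, x, ⟨?_, ?_⟩, ?_, ?_⟩)
  · rintro _ ⟨T, _, hT, _⟩
    exact hT.card_eq ▸ Finset.card_le_univ T
  · intro u hu v hv _
    simp only [Finset.coe_insert, Set.mem_insert_iff, Finset.mem_coe] at hu hv
    rcases hu with rfl | hu <;> rcases hv with rfl | hv
    · exact G.loopless.irrefl _
    · exact hx v hv
    · exact fun h => hx u hu h.symm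
    · exact hind u hu v hv
  · exact Finset.card_insert_of_notMem hxS
  · exact Finset.mem_insert_self x S
  · intro v hv hvx
    exact hdist v ((Finset.mem_insert.1 hv).resolve_left hvx)

end SimpleGraph

/-! ### The main theorem -/

open SimpleGraph in
theorem corollary1p9 {V : Type*} [Fintype V] [DecidableEq V] (G : SimpleGraph V) (k : ℕ)
    (hk : 2 ≤ k) (htough : G.IsTough 1) (hconn : G.IsKConnected k)
    (hfree : G.IsInducedFree (SimpleGraph.P2UnionKP1 k))
    (halpha : G.essentialIndepNum ≤ k) :
    G.IsHamiltonian := by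
  classical
  obtain ⟨c, hc, hmax⟩ := hconn.exists_maximal_isCyclicPath hk
  refine hc.isHamiltonian fun x => ?_
  by_contra hxc
  have hn := hc.nodup
  have h3 := hc.three_le
  let T : Set V := {v | v ∉ c}
  let D : Set V := {v | ∃ hv : v ∈ T, (G.induce T).Reachable ⟨x, hxc⟩ ⟨v, hv⟩}
  have hxD : x ∈ D := ⟨hxc, .rfl⟩
  have hDT : ∀ v ∈ D, v ∉ c := fun v hv => hv.1
  have hDclosed : ∀ v ∈ D, ∀ w, G.Adj v w → w ∉ c → w ∈ D := fun v ⟨hv, hr⟩ w hvw hw =>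
    ⟨hw, hr.trans (Adj.reachable (G := G.induce T) (u := ⟨v, hv⟩) (v := ⟨w, hw⟩) hvw)⟩
  have hpath : ∀ a ∈ D, ∀ b ∈ D, ∃ R : List V, R.Nodup ∧ R.IsChain G.Adj ∧ (∀ v ∈ R, v ∈ T) ∧
      R.head? = some a ∧ R.getLast? = some b := fun a ⟨_, hra⟩ b ⟨_, hrb⟩ =>
    exists_list_of_reachable_induce (hra.symm.trans hrb)
  let N : Finset V := Finset.univ.filter fun u => u ∈ c ∧ ∃ d ∈ D, G.Adj u d
  have hN : ∀ u, u ∈ N ↔ u ∈ c ∧ ∃ d ∈ D, G.Adj u d := fun u => by simp [N]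
  set s := cycleSucc c hn with hs
  have hcut : ∀ u ∈ c, ∃ l : List V, c = ↑(s u :: (l ++ [u])) := fun u hu =>
    exists_coe_eq_cycleSucc_cons hn (by omega) hu
  have hsN : ∀ u ∈ N, s u ∉ N := by
    intro u hu hsu
    obtain ⟨huc, a, ha, hua⟩ := (hN u).1 hu
    obtain ⟨-, b, hb, hvb⟩ := (hN _).1 hsu
    obtain ⟨R, hRn, hR, hRT, hRa, hRb⟩ := hpath a ha b hb
    obtain ⟨l, hl⟩ := hcut u huc
    obtain ⟨c', hc', hlt⟩ := IsCyclicPath.exists_longer_of_consecutive (hl ▸ hc) hRn hR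
      (fun v hv hv' => hRT v hv (by rw [hl]; exact hv')) hRa hRb hua hvb
    have hle := hmax c' hc'
    rw [hl, Cycle.length_coe] at hle
    omega
  have hss : ∀ u ∈ N, ∀ w ∈ N, ¬ G.Adj (s u) (s w) := by
    intro u hu w hw hadj
    obtain ⟨huc, b, hb, hub⟩ := (hN u).1 hu
    obtain ⟨hwc, a, ha, hwa⟩ := (hN w).1 hw
    obtain ⟨R, hRn, hR, hRT, hRa, hRb⟩ := hpath a ha b hb
    obtain ⟨l, hl⟩ := hcut u huc
    have hwu : w ≠ u := by rintro rfl; exact G.loopless.irrefl _ hadj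
    have hwl : w ∈ s u :: l := by
      rw [hl, Cycle.mem_coe_iff, ← List.cons_append, List.mem_append] at hwc
      simpa [hwu] using hwc
    -- Cutting after `w` as well as after `u` splits `c` into the arcs from `s u` to `w` and from `s
    -- w` to `u`.
    obtain ⟨A, B, hAB⟩ := List.append_of_mem hwl
    have hsplit : s u :: (l ++ [u]) = (A ++ [w]) ++ (B ++ [u]) := by
      rw [← List.cons_append, hAB]; simp
    rw [hsplit] at hl
    have hA : (A ++ [w]).head? = some (s u) := by
      have := congrArg List.head? hAB
      cases A <;> simpa using this.symm
    have hB : (B ++ [u]).head? = some (s w) := by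
      rcases hBu : B ++ [u] with _ | ⟨v, m⟩
      · simp at hBu
      · rw [hBu] at hl
        have : c = ↑(v :: ((m ++ A) ++ [w])) := by
          rw [hl, Cycle.coe_eq_coe]
          simpa using List.isRotated_append (l := A ++ [w]) (l' := v :: m)
        rw [hs, cycleSucc_eq hn this, List.head?_cons]
    obtain ⟨c', hc', hlt⟩ := IsCyclicPath.exists_longer_of_crossing (hl ▸ hc) hRn hR
      (fun v hv hv' => hRT v hv (by rw [hl]; exact hv')) hRa hRb hA (by simp) hB (by simp)
      hwa hub hadj
    have hle := hmax c' hc'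
    rw [hl, Cycle.length_coe] at hle
    omega
  -- Separation by `N` requires a vertex beyond `N`: the successor of any member of `N` is one.
  have hcN : ∃ y ∈ c, y ∉ N := by
    by_cases hne : N.Nonempty
    · obtain ⟨u, hu⟩ := hne
      exact ⟨s u, cycleSucc_mem hn ((hN u).1 hu).1, hsN u hu⟩
    · obtain ⟨y, hy⟩ : ∃ y, y ∈ c := by
        obtain ⟨l, rfl⟩ : ∃ l : List V, ↑l = c := Quot.exists_rep c
        exact List.exists_mem_of_length_pos (l := l) (lt_of_lt_of_le (by norm_num) h3)
      exact ⟨y, hy, fun h => hne ⟨y, h⟩⟩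
  obtain ⟨y, hyc, hyN⟩ := hcN
  have hcard : k ≤ N.card := hconn.le_card_of_separates N D hxD (fun h => hxc ((hN x).1 h).1)
    (fun h => hDT y h hyc) hyN fun v hv w hvw hwN =>
      hDclosed v hv w hvw fun hwc => hwN ((hN w).2 ⟨hwc, v, hv, hvw.symm⟩)
  have himage : (N.image s).card = N.card := Finset.card_image_of_injOn
    ((cycleSucc_injOn hn).mono fun u hu => ((hN u).1 hu).1)
  have hind : ∀ u ∈ N.image s, ∀ v ∈ N.image s, ¬ G.Adj u v := by
    simpa [Finset.forall_mem_image] using hss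
  have hDS : ∀ d ∈ D, ∀ v ∈ N.image s, ¬ G.Adj d v := by
    intro d hd v hv hdv
    obtain ⟨u, hu, rfl⟩ := Finset.mem_image.1 hv
    exact hsN u hu ((hN _).2 ⟨cycleSucc_mem hn ((hN u).1 hu).1, d, hd, hdv.symm⟩)
  by_cases hedge : ∃ d, d ∉ c ∧ G.Adj x d
  · obtain ⟨d, hdc, hxd⟩ := hedge
    exact hfree (isIndContained_P2UnionKP1 (hcard.trans_eq himage.symm) hxd hind (hDS x hxD)
      (hDS d (hDclosed x hxD d hxd hdc)))
  · push Not at hedge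
    have hDx : ∀ d ∈ D, d = x := by
      rintro d ⟨hd, ⟨p⟩⟩
      cases p with
      | nil => rfl
      | @cons _ b _ h _ => exact absurd h (hedge b.1 b.2)
    have hxS : x ∉ N.image s := by
      intro h
      obtain ⟨u, hu, hux⟩ := Finset.mem_image.1 h
      exact hxc (hux ▸ cycleSucc_mem hn ((hN u).1 hu).1)
    have hadj : ∀ u ∈ c, G.Adj u (s u) := by
      intro u hu
      obtain ⟨l, hl⟩ := hcut u hu
      have hch := hc.chain
      rw [hl, chain_coe_iff (by simp)] at hch
      exact hch.2 u (by rw [← List.cons_append, List.getLast?_concat]; rfl) (s u) (by simp)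
    have hlt := card_lt_essentialIndepNum (G := G) hxS hind (hDS x hxD) fun v hv => by
      obtain ⟨u, hu, rfl⟩ := Finset.mem_image.1 hv
      obtain ⟨huc, d, hd, hud⟩ := (hN u).1 hu
      exact dist_eq_two_of_adj_adj (hDx d hd ▸ hud.symm) (hadj u huc)
        (fun h => hxS (h ▸ hv)) (hDS x hxD _ hv)
    -- `k ≤ |N| = |s(N)| < α_e(G) ≤ k`.
    omega
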